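/- Let $d\ge 1$ be an integer, let $\mathbb F_d^+$ be the free semigroup (with empty word $\emptyset$) on the letters $1,\dots,d$, and for a tuple $T=(T_1,\dots,T_d)$ of bounded operators put $T^{\alpha}=T_{i_1}\cdots T_{i_k}$ for $\alpha=i_1\cdots i_k$, $T^{\emptyset}=I$, and $f(T)=\sum_\alpha c_\alpha T^\alpha$ for a noncommutative polynomial $f=\sum_\alpha c_\alpha Z^\alpha$ with complex coefficients. Let $(\Omega,\mathbb P)$ be a probability space, $H$ a complex Hilbert space, and $A=(A_1,\dots,A_d)$ a tuple of random operators $A_i:\Omega\to\mathcal L(H)$ which are strongly measurable ($\omega\mapsto A_i(\omega)u$ and $\omega\mapsto A_i(\omega)^*u$ are strongly measurable for each $u\in H$; the second is automatic if $H$ is separable) with $\mathbb E\,\|A^\alpha\|^2<\infty$ for every word $\alpha$. Define the kernels $$K(\alpha,\beta)=\mathbb E\big[A^\alpha (A^\beta)^*\big],\qquad K_\Sigma(\alpha,\beta)=\sum_{i=1}^d K(\alpha i,\beta i),$$ where the expectation of a random operator $X$ is taken in the strong sense, $\mathbb E[X]u=\mathbb E[Xu]$. Assume that $K_\Sigma\le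 K$, i.e. that $K-K_\Sigma$ is positive definite: $\sum_{j,k}\langle u_j,(K-K_\Sigma)(\alpha_j,\alpha_k)u_k\rangle\ge 0$ for all finite families of words $\alpha_j$ and vectors $u_j\in H$. Call $(\mathcal K,S,P,W)$ a Cuntz dilation of $K$ if $\mathcal K$ is a Hilbert space, $S=(S_1,\dots,S_d)$ is a Cuntz family on $\mathcal K$ ($S_i^*S_j=\delta_{ij}I$, $\sum_i S_iS_i^*=I$), $P$ is an orthogonal projection on $\mathcal K$, $W:H\to\mathcal K$ is an isometry, $K(\alpha,\beta)=W^*S^\alpha P(S^\beta)^*W$ for all words $\alpha,\beta$, and $\langle y,\sum_i S_iPS_i^*y\rangle\le\langle y,Py\rangle$ for all $y$ in $M=\overline{\mathrm{span}}\{(S^\gamma)^*Wu:\gamma\in\mathbb F_d^+,\ u\in H\}$. Then a Cuntz dilation of $K$ exists, and for every Cuntz dilation $(\mathcal K,S,P,W)$ of $K$, every noncommutative polynomial $f$ and every $u\in H$, $$\mathbb E\big[\|f(A)^*u\|^2\big]\le\|f(S)\|^2\|u\|^2\le\|f(L)\|^2\|u\|^2,$$ where $L=(L_1,\dots,L_d)$,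 $L_ie_\alpha=e_{i\alpha}$, are the left creation operators on the full Fock space $\ell^2(\mathbb F_d^+)$ (in particular the first expectation is finite). Equivalently to the resulting bound by $\|f(L)\|^2\|u\|^2$, for every noncommutative polynomial $f$ the expectation $\mathbb E[f(A)f(A)^*]$ exists as a bounded operator on $H$ and $$\mathbb E\big[f(A)f(A)^*\big]\le\|f(L)\|^2 I_H .$$ -/

import Mathlib

open MeasureTheory ContinuousLinearMap
open scoped ComplexOrder InnerProductSpace

universe u v w

namespace FreeMoment

/-- Words in the letters `0, …, d - 1`: the free semigroup with neutral element the empty word. -/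
abbrev Word (d : ℕ) : Type := FreeMonoid (Fin d)

/-- Noncommutative polynomials in `d` variables with complex coefficients. -/
abbrev NCPoly (d : ℕ) : Type := FreeAlgebra ℂ (Fin d)

section Operators

variable {d : ℕ} {E : Type u} [NormedAddCommGroup E] [InnerProductSpace ℂ E]

/-- `wordOp T α = T^α = T_{i₁} ⋯ T_{iₖ}` for `α = i₁ ⋯ iₖ`, and the identity for the empty word. -/
noncomputable def wordOp (T : Fin d → E →L[ℂ] E) (α : Word d) : E →L[ℂ] E :=
  FreeMonoid.lift T α

/-- Evaluation `f(T)` of a noncommutative polynomial at a tuple of operators. -/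
noncomputable def polyOp (f : NCPoly d) (T : Fin d → E →L[ℂ] E) : E →L[ℂ] E :=
  FreeAlgebra.lift ℂ T f

end Operators

section Random

variable {Ω : Type v} [MeasurableSpace Ω] {H : Type u} [NormedAddCommGroup H]
  [InnerProductSpace ℂ H] [CompleteSpace H]

/-- Strong measurability of an operator-valued random variable: `ω ↦ X(ω) u` and
`ω ↦ X(ω)^* u` are (a.e.) strongly measurable for every vector `u`. When `H` is separable, the
second condition follows from the first; in general both follow from (a.e.) strong measurability
of `X` for the operator norm. -/
structure IsRandomOperator (μ : Measure Ω) (X : Ω → H →L[ℂ] H) : Prop where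
  apply : ∀ u : H, AEStronglyMeasurable (fun ω => X ω u) μ
  adjoint_apply : ∀ u : H, AEStronglyMeasurable (fun ω => (adjoint (X ω)) u) μ

/-- `T` is the expectation of the random operator `X`, in the strong sense:
`E[X u] = T u` for every vector `u`, with `X u` Bochner integrable. -/
def IsExpectation (μ : Measure Ω) (X : Ω → H →L[ℂ] H) (T : H →L[ℂ] H) : Prop :=
  ∀ u : H, Integrable (fun ω => X ω u) μ ∧ ∫ ω, X ω u ∂μ = T u

open scoped Classical in
/-- The expectation `E[X]` of a random operator (and `0` if it does not exist). -/
noncomputable def expectation (μ : Measure Ω) (X : Ω → H →L[ℂ] H) : H →L[ℂ] H :=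
  if h : ∃ T : H →L[ℂ] H, IsExpectation μ X T then h.choose else 0

/-- The moment kernel `K(α, β) = E[A^α (A^β)^*]`. -/
noncomputable def momentKernel {d : ℕ} (μ : Measure Ω) (A : Fin d → Ω → H →L[ℂ] H)
    (α β : Word d) : H →L[ℂ] H :=
  expectation μ (fun ω => wordOp (fun i => A i ω) α ∘L adjoint (wordOp (fun i => A i ω) β))

end Random

section Kernels

variable {d : ℕ} {H : Type u} [NormedAddCommGroup H] [InnerProductSpace ℂ H]

/-- The shifted kernel `K_Σ(α, β) = ∑ᵢ K(αi, βi)`. -/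
noncomputable def shiftedKernel (K : Word d → Word d → H →L[ℂ] H) (α β : Word d) : H →L[ℂ] H :=
  ∑ i : Fin d, K (α * FreeMonoid.of i) (β * FreeMonoid.of i)

/-- Positive definiteness of an operator-valued kernel. -/
def IsPDKernel (K : Word d → Word d → H →L[ℂ] H) : Prop :=
  ∀ (N : ℕ) (α : Fin N → Word d) (u : Fin N → H),
    0 ≤ ∑ j : Fin N, ∑ k : Fin N, ⟪u j, K (α j) (α k) (u k)⟫_ℂ

/-- The positive-definite order: `K₁` is dominated by `K₂` if `K₂ - K₁` is positive definite. -/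
def KernelLE (K₁ K₂ : Word d → Word d → H →L[ℂ] H) : Prop :=
  IsPDKernel (fun α β => K₂ α β - K₁ α β)

end Kernels

section Dilation

variable {d : ℕ} {H : Type u} [NormedAddCommGroup H] [InnerProductSpace ℂ H] [CompleteSpace H]
  {E : Type w} [NormedAddCommGroup E] [InnerProductSpace ℂ E] [CompleteSpace E]

/-- A Cuntz family: isometries with orthogonal ranges that sum up to the whole space. -/
structure IsCuntzFamily (S : Fin d → E →L[ℂ] E) : Prop where
  adjoint_comp : ∀ i j, adjoint (S i) ∘L S j = if i = j then ContinuousLinearMap.id ℂ E else 0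
  sum_comp_adjoint : ∑ i, S i ∘L adjoint (S i) = ContinuousLinearMap.id ℂ E

/-- The closed linear span `M` of the vectors `(S^γ)^* W u`. -/
noncomputable def cyclicSpace (S : Fin d → E →L[ℂ] E) (W : H →ₗᵢ[ℂ] E) : Submodule ℂ E :=
  (Submodule.span ℂ
    {y : E | ∃ (γ : Word d) (u : H), y = adjoint (wordOp S γ) (W u)}).topologicalClosure

/-- `(S, P, W)` is a dilation of the kernel `K`: `S` is a Cuntz family, `P` an orthogonal
projection and `W` an isometry with `K(α, β) = W^* S^α P (S^β)^* W`, and `∑ᵢ Sᵢ P Sᵢ^* ≤ P` holds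
as an inequality of quadratic forms on `M`. -/
structure IsDilation (K : Word d → Word d → H →L[ℂ] H) (S : Fin d → E →L[ℂ] E)
    (P : E →L[ℂ] E) (W : H →ₗᵢ[ℂ] E) : Prop where
  cuntz : IsCuntzFamily S
  proj : IsStarProjection P
  kernel_eq : ∀ α β : Word d,
    K α β = adjoint W.toContinuousLinearMap ∘L wordOp S α ∘L P ∘L adjoint (wordOp S β) ∘L
      W.toContinuousLinearMap
  sum_le : ∀ y ∈ cyclicSpace S W,
    (⟪y, (∑ i, S i ∘L P ∘L adjoint (S i)) y⟫_ℂ).re ≤ (⟪y, P y⟫_ℂ).re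

end Dilation

section Fock

variable {d : ℕ}

/-- The full Fock space `ℓ²` over the set of words. -/
abbrev FullFock (d : ℕ) : Type := lp (fun _ : Word d => ℂ) 2

/-- The function with value `x v` at the word `i v` and `0` at all words not starting with `i`. -/
noncomputable def shiftFun (i : Fin d) (x : Word d → ℂ) : Word d → ℂ :=
  Function.extend (fun v : Word d => FreeMonoid.of i * v) x 0

theorem of_mul_injective (i : Fin d) :
    Function.Injective (fun v : Word d => FreeMonoid.of i * v) :=
  fun _ _ h => mul_left_cancel h

theorem norm_shiftFun_rpow (i : Fin d) (x : Word d → ℂ) :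
    (fun v => ‖shiftFun i x v‖ ^ (2 : ENNReal).toReal) =
      Function.extend (fun v : Word d => FreeMonoid.of i * v)
        (fun v => ‖x v‖ ^ (2 : ENNReal).toReal) 0 := by
  funext v
  by_cases h : ∃ t : Word d, FreeMonoid.of i * t = v
  · obtain ⟨t, rfl⟩ := h
    rw [shiftFun, (of_mul_injective i).extend_apply, (of_mul_injective i).extend_apply]
  · rw [shiftFun, Function.extend_apply' _ _ _ h, Function.extend_apply' _ _ _ h]
    simp

theorem memlp_shiftFun (i : Fin d) (x : FullFock d) : Memℓp (shiftFun i x) 2 := by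
  apply memℓp_gen
  rw [norm_shiftFun_rpow]
  exact (summable_extend_zero (of_mul_injective i)).2 (x.2.summable (by simp))

/-- The left creation operator `Lᵢ : e_α ↦ e_{iα}` on the full Fock space, as an isometry. -/
noncomputable def leftCreationIsometry (i : Fin d) : FullFock d →ₗᵢ[ℂ] FullFock d where
  toFun x := ⟨shiftFun i x, memlp_shiftFun i x⟩
  map_add' x y := by
    ext v
    change shiftFun i (⇑x + ⇑y) v = shiftFun i x v + shiftFun i y v
    by_cases h : ∃ t : Word d, FreeMonoid.of i * t = v
    · obtain ⟨t, rfl⟩ := h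
      simp only [shiftFun, (of_mul_injective i).extend_apply, Pi.add_apply]
    · simp [shiftFun, Function.extend_apply' _ _ _ h]
  map_smul' c x := by
    ext v
    by_cases h : ∃ t : Word d, FreeMonoid.of i * t = v
    · obtain ⟨t, rfl⟩ := h
      simp [shiftFun, (of_mul_injective i).extend_apply]
    · simp [shiftFun, Function.extend_apply' _ _ _ h]
  norm_map' x := by
    have h2 : 0 < (2 : ENNReal).toReal := by simp
    rw [lp.norm_eq_tsum_rpow h2, lp.norm_eq_tsum_rpow h2 x]
    congr 1
    change ∑' v, ‖shiftFun i x v‖ ^ (2 : ENNReal).toReal = _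
    rw [norm_shiftFun_rpow, tsum_extend_zero (of_mul_injective i)]

/-- The tuple `L = (L₁, …, L_d)` of left creation operators on the full Fock space. -/
noncomputable def leftCreation (d : ℕ) (i : Fin d) : FullFock d →L[ℂ] FullFock d :=
  (leftCreationIsometry i).toContinuousLinearMap

end Fock

end FreeMoment

/-!
A Cuntz dilation `(S, P, W)` of the moment kernel gives
`E[f(A) f(A)^*] = W^* f(S) P f(S)^* W`, expanding both sides in words, whence
`E‖f(A)^* u‖² = ‖P f(S)^* W u‖² ≤ ‖f(S)‖² ‖u‖²` (`integral_norm_sq_le`). What remains is the norm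
inequality `‖f(S)‖ ≤ ‖f(L)‖` and the existence of a dilation.

**Norm inequality** (`IsCuntzFamily.norm_polyOp_le`). For `0 ≤ r < 1` the vectors
`x(α) = r^{|α|} (S^α)^* y` have `∑ ‖x(α)‖² = ‖y‖² / (1 - r²)`, because `∑ᵢ Sᵢ Sᵢ^* = I`, and the
adjoint of `f(L) ⊗ I` maps `x` to the family `r^{|β|} (S^β)^* f(rS)^* y`, of square norm
`‖f(rS)^* y‖² / (1 - r²)`. Hence `‖f(rS)^* y‖ ≤ ‖f(L)‖ ‖y‖`, and `r → 1` gives the claim. This is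
the Poisson transform, written out coordinatewise.

**Existence of a dilation** (`exists_isDilation_momentKernel`). The vectors `φ α u = (A^α)^* u` of
`L²(Ω; H)` satisfy `⟪u, K(α, β) v⟫ = ⟪φ α u, φ β v⟫`. The condition `K_Σ ≤ K` says that the
operators `Tᵢ : φ α u ↦ φ (α i) u` are well defined on the closed span `M` of these vectors and
form a contractive column; so `K(α, β) = W₀^* V^α (V^β)^* W₀` for the row contraction
`Vᵢ = Tᵢ^*`. Two extensions turn it into a Cuntz family. First, the column `T` lifts
to an isometric column `B` on `ℓ²(𝔽_d^+) ⊗ M`, using the defect operator `(I - ∑ Tᵢ^* Tᵢ)^{1/2}`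
(`exists_isometric_column`). Then `B` extends to a unitary column by adding a Fock space over
the orthogonal complement of its range (`exists_cuntzFamily_of_isometric_column`). The adjoints of
the entries form the Cuntz family, and `P` is the projection onto `M`.
-/

namespace FreeMoment

/-! ### Noncommutative polynomials as sums over words -/

section Words

variable {d : ℕ} {E : Type u} [NormedAddCommGroup E] [InnerProductSpace ℂ E]

@[simp] theorem wordOp_one (T : Fin d → E →L[ℂ] E) : wordOp T 1 = ContinuousLinearMap.id ℂ E :=
  map_one (FreeMonoid.lift T)

@[simp] theorem wordOp_of (T : Fin d → E →L[ℂ] E) (i : Fin d) :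
    wordOp T (FreeMonoid.of i) = T i :=
  FreeMonoid.lift_eval_of T i

theorem wordOp_mul (T : Fin d → E →L[ℂ] E) (α β : Word d) :
    wordOp T (α * β) = wordOp T α ∘L wordOp T β :=
  map_mul (FreeMonoid.lift T) α β

theorem adjoint_wordOp_mul_apply [CompleteSpace E] (T : Fin d → E →L[ℂ] E) (α β : Word d) (x : E) :
    adjoint (wordOp T (α * β)) x = adjoint (wordOp T β) (adjoint (wordOp T α) x) := by
  rw [wordOp_mul, adjoint_comp, comp_apply]

theorem adjoint_wordOp_one_apply [CompleteSpace E] (T : Fin d → E →L[ℂ] E) (x : E) :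
    adjoint (wordOp T 1) x = x := by
  rw [wordOp_one, adjoint_id, id_apply]

/-- The coefficients `c_α` of a noncommutative polynomial `f = ∑ c_α Z^α`. -/
noncomputable def coeff (f : NCPoly d) : Word d →₀ ℂ :=
  (FreeAlgebra.equivMonoidAlgebraFreeMonoid (R := ℂ) f).coeff

theorem polyOp_eq_sum (f : NCPoly d) (T : Fin d → E →L[ℂ] E) :
    polyOp f T = ∑ α ∈ (coeff f).support, coeff f α • wordOp T α := by
  have h : (FreeAlgebra.lift ℂ T : NCPoly d →ₐ[ℂ] (E →L[ℂ] E)) =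
      (MonoidAlgebra.lift ℂ (E →L[ℂ] E) (FreeMonoid (Fin d)) (FreeMonoid.lift T)).comp
        (FreeAlgebra.equivMonoidAlgebraFreeMonoid (R := ℂ) (X := Fin d)).toAlgHom := by
    ext i : 2
    simp [FreeAlgebra.equivMonoidAlgebraFreeMonoid]
  rw [polyOp, h, AlgHom.comp_apply, MonoidAlgebra.lift_apply]
  rfl

theorem adjoint_polyOp_apply [CompleteSpace E] (f : NCPoly d) (T : Fin d → E →L[ℂ] E) (x : E) :
    adjoint (polyOp f T) x =
      ∑ α ∈ (coeff f).support, star (coeff f α) • adjoint (wordOp T α) x := by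
  simp only [polyOp_eq_sum, map_sum, map_smulₛₗ, sum_apply, smul_apply]
  rfl

end Words

/-! ### The norm inequality for Cuntz families -/

section VonNeumann

variable {d : ℕ}

theorem tsum_enorm_sq_lp {ι G : Type*} [NormedAddCommGroup G] (x : lp (fun _ : ι => G) 2) :
    ∑' i, ‖x i‖ₑ ^ 2 = ‖x‖ₑ ^ 2 := by
  have h := lp.hasSum_norm (p := 2) (by simp) x
  simp only [ENNReal.toReal_ofNat, Real.rpow_ofNat] at h
  simp only [← ofReal_norm, ← ENNReal.ofReal_pow (norm_nonneg _)]
  rw [← ENNReal.ofReal_tsum_of_nonneg (fun _ => by positivity) h.summable, h.tsum_eq]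

theorem memℓp_two_of_tsum_ne_top {ι G : Type*} [NormedAddCommGroup G] {x : ι → G}
    (h : ∑' i, ‖x i‖ₑ ^ 2 ≠ ⊤) : Memℓp x 2 := by
  apply memℓp_gen
  simpa using ENNReal.summable_toReal h

theorem tsum_enorm_sq_repr {ι E : Type*} [NormedAddCommGroup E]
    [InnerProductSpace ℂ E] (b : HilbertBasis ι ℂ E) (x : E) :
    ∑' i, ‖b.repr x i‖ₑ ^ 2 = ‖x‖ₑ ^ 2 := by
  rw [tsum_enorm_sq_lp, ← ofReal_norm, ← ofReal_norm, b.repr.norm_map]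

open scoped Classical in
theorem leftCreation_single (i : Fin d) (β : Word d) (z : ℂ) :
    leftCreation d i (lp.single 2 β z) = lp.single 2 (FreeMonoid.of i * β) z := by
  ext v
  change shiftFun i (Pi.single β z : Word d → ℂ) v =
    (Pi.single (FreeMonoid.of i * β) z : Word d → ℂ) v
  by_cases h : ∃ t : Word d, FreeMonoid.of i * t = v
  · obtain ⟨t, rfl⟩ := h
    rw [shiftFun, (of_mul_injective i).extend_apply]
    simp [Pi.single_apply]
  · rw [shiftFun, Function.extend_apply' _ _ _ h, Pi.single_eq_of_ne]
    · rfl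
    · rintro rfl
      exact h ⟨β, rfl⟩

open scoped Classical in
theorem wordOp_leftCreation_single (α β : Word d) (z : ℂ) :
    wordOp (leftCreation d) α (lp.single 2 β z) = lp.single 2 (α * β) z := by
  induction α using FreeMonoid.recOn generalizing β with
  | one => simp
  | of_mul i α ih => rw [wordOp_mul, comp_apply, ih, wordOp_of, leftCreation_single, mul_assoc]

open scoped Classical in
theorem adjoint_wordOp_leftCreation_apply (α β : Word d) (x : FullFock d) :
    adjoint (wordOp (leftCreation d) α) x β = x (α * β) := by
  have h := lp.inner_single_left (𝕜 := ℂ) β (1 : ℂ) (adjoint (wordOp (leftCreation d) α) x)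
  rw [adjoint_inner_right, wordOp_leftCreation_single, lp.inner_single_left] at h
  simpa using h.symm

/-- The bound `‖f(L)^* x‖² ≤ ‖f(L)‖² ‖x‖²` in coordinates, since `((L^α)^* x)(β) = x(α β)`. -/
theorem tsum_enorm_sq_fock_le (f : NCPoly d) {x : Word d → ℂ} (hx : ∑' α, ‖x α‖ₑ ^ 2 ≠ ⊤) :
    ∑' β, ‖∑ α ∈ (coeff f).support, star (coeff f α) • x (α * β)‖ₑ ^ 2 ≤
      ‖polyOp f (leftCreation d)‖ₑ ^ 2 * ∑' α, ‖x α‖ₑ ^ 2 := by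
  let X : FullFock d := ⟨x, memℓp_two_of_tsum_ne_top hx⟩
  have h1 : ∀ β, adjoint (polyOp f (leftCreation d)) X β =
      ∑ α ∈ (coeff f).support, star (coeff f α) • x (α * β) := by
    intro β
    rw [adjoint_polyOp_apply, lp.coeFn_sum, Finset.sum_apply]
    refine Finset.sum_congr rfl fun α _ => ?_
    rw [lp.coeFn_smul, Pi.smul_apply, adjoint_wordOp_leftCreation_apply]
  have h2 : ∑' α, ‖x α‖ₑ ^ 2 = ‖X‖ₑ ^ 2 := tsum_enorm_sq_lp X
  simp only [← h1]
  rw [h2, tsum_enorm_sq_lp, ← mul_pow]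
  gcongr
  have := (adjoint (polyOp f (leftCreation d))).le_opNorm X
  rw [LinearIsometryEquiv.norm_map] at this
  simpa only [← ofReal_norm, ← ENNReal.ofReal_mul (norm_nonneg _)] using
    ENNReal.ofReal_le_ofReal this

variable {E : Type w} [NormedAddCommGroup E] [InnerProductSpace ℂ E] [CompleteSpace E]

/-- The operator `f(L)^* ⊗ I` on the `E`-valued Fock space is bounded by `‖f(L)‖`; this is seen
coordinatewise in a Hilbert basis of `E`. -/
theorem tsum_enorm_sq_fock_vector_le (f : NCPoly d) {x : Word d → E}
    (hx : ∑' α, ‖x α‖ₑ ^ 2 ≠ ⊤) :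
    ∑' β, ‖∑ α ∈ (coeff f).support, star (coeff f α) • x (α * β)‖ₑ ^ 2 ≤
      ‖polyOp f (leftCreation d)‖ₑ ^ 2 * ∑' α, ‖x α‖ₑ ^ 2 := by
  obtain ⟨s, b, -⟩ := exists_hilbertBasis ℂ E
  have hs : ∑' i, ∑' α, ‖b.repr (x α) i‖ₑ ^ 2 = ∑' α, ‖x α‖ₑ ^ 2 := by
    rw [ENNReal.tsum_comm]
    simp only [tsum_enorm_sq_repr]
  calc _ = ∑' β, ∑' i, ‖∑ α ∈ (coeff f).support,
          star (coeff f α) • b.repr (x (α * β)) i‖ₑ ^ 2 := by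
        refine tsum_congr fun β => ?_
        rw [← tsum_enorm_sq_repr b]
        refine tsum_congr fun i => ?_
        rw [map_sum, lp.coeFn_sum, Finset.sum_apply]
        simp only [map_smul, lp.coeFn_smul, Pi.smul_apply]
    _ = ∑' i, ∑' β, ‖∑ α ∈ (coeff f).support,
          star (coeff f α) • b.repr (x (α * β)) i‖ₑ ^ 2 := ENNReal.tsum_comm
    _ ≤ ∑' i, ‖polyOp f (leftCreation d)‖ₑ ^ 2 * ∑' α, ‖b.repr (x α) i‖ₑ ^ 2 := by
        refine ENNReal.tsum_le_tsum fun i =>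
          tsum_enorm_sq_fock_le f (x := fun α => b.repr (x α) i) ?_
        rw [← hs] at hx
        exact ENNReal.ne_top_of_tsum_ne_top hx i
    _ = _ := by rw [ENNReal.tsum_mul_left, hs]

theorem IsCuntzFamily.sum_enorm_sq {S : Fin d → E →L[ℂ] E} (hS : IsCuntzFamily S) (y : E) :
    ∑ i, ‖adjoint (S i) y‖ₑ ^ 2 = ‖y‖ₑ ^ 2 := by
  have h : ∑ i, ‖adjoint (S i) y‖ ^ 2 = ‖y‖ ^ 2 := by
    have h0 : ⟪∑ i, S i (adjoint (S i) y), y⟫_ℂ = ⟪y, y⟫_ℂ := by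
      have := congrArg (fun B : E →L[ℂ] E => B y) hS.sum_comp_adjoint
      simp only [sum_apply, comp_apply, id_apply] at this
      rw [this]
    rw [sum_inner] at h0
    simp only [← adjoint_inner_right, inner_self_eq_norm_sq_to_K] at h0
    exact_mod_cast h0
  simp only [← ofReal_norm, ← ENNReal.ofReal_pow (norm_nonneg _), ← h]
  rw [ENNReal.ofReal_sum_of_nonneg fun _ _ => by positivity]

/-- The words of each length `n` contribute the same amount: `∑_{|α| = n} ‖(S^α)^* y‖² = ‖y‖²`. -/
theorem IsCuntzFamily.sum_enorm_sq_length {S : Fin d → E →L[ℂ] E} (hS : IsCuntzFamily S) (n : ℕ)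
    (y : E) :
    ∑ v : Fin n → Fin d, ‖adjoint (wordOp S (FreeMonoid.ofList (List.ofFn v))) y‖ₑ ^ 2 =
      ‖y‖ₑ ^ 2 := by
  induction n generalizing y with
  | zero => simp [adjoint_id]
  | succ n ih =>
    rw [← (Fin.consEquiv fun _ => Fin d).sum_comp, Fintype.sum_prod_type, ← hS.sum_enorm_sq y]
    refine Finset.sum_congr rfl fun i _ => ?_
    rw [← ih (adjoint (S i) y)]
    refine Finset.sum_congr rfl fun v _ => ?_
    have : FreeMonoid.ofList (List.ofFn (Fin.consEquiv (fun _ => Fin d) (i, v))) =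
        FreeMonoid.of i * FreeMonoid.ofList (List.ofFn v) := by
      simp [Fin.consEquiv, List.ofFn_succ]
    rw [this, adjoint_wordOp_mul_apply, wordOp_of]

/-- Summation over words, arranged by length. -/
theorem tsum_word (g : Word d → ENNReal) :
    ∑' α, g α = ∑' n, ∑ v : Fin n → Fin d, g (FreeMonoid.ofList (List.ofFn v)) := by
  rw [← (List.equivSigmaTuple.symm.trans FreeMonoid.ofList).tsum_eq g, ENNReal.tsum_sigma']
  refine tsum_congr fun n => ?_
  rw [tsum_fintype]
  rfl

theorem IsCuntzFamily.tsum_geometric {S : Fin d → E →L[ℂ] E} (hS : IsCuntzFamily S) (r : ℝ)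
    (y : E) :
    ∑' α : Word d, ‖(r : ℂ) ^ α.length • adjoint (wordOp S α) y‖ₑ ^ 2 =
      (1 - ‖r‖ₑ ^ 2)⁻¹ * ‖y‖ₑ ^ 2 := by
  rw [tsum_word, ← ENNReal.tsum_geometric, ← ENNReal.tsum_mul_right]
  refine tsum_congr fun n => ?_
  rw [← hS.sum_enorm_sq_length n y, Finset.mul_sum]
  refine Finset.sum_congr rfl fun v _ => ?_
  have hr : ‖(r : ℂ)‖ₑ = ‖r‖ₑ := by simp [← ofReal_norm]
  rw [enorm_smul, enorm_pow, mul_pow, hr, pow_right_comm]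
  simp [FreeMonoid.length]

/-- The von Neumann inequality for the dilated tuple `rS`, `0 ≤ r < 1`: the vectors
`r^{|α|} (S^α)^* y` form an element of the `E`-valued Fock space, on which `f(L)^* ⊗ I` acts as
`f(rS)^*` acts on `y`. -/
theorem IsCuntzFamily.norm_adjoint_radial_le {S : Fin d → E →L[ℂ] E} (hS : IsCuntzFamily S)
    (f : NCPoly d) {r : ℝ} (h0 : 0 ≤ r) (h1 : r < 1) (y : E) :
    ‖∑ α ∈ (coeff f).support, star (coeff f α) • (r : ℂ) ^ α.length • adjoint (wordOp S α) y‖ ≤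
      ‖polyOp f (leftCreation d)‖ * ‖y‖ := by
  set z := ∑ α ∈ (coeff f).support,
    star (coeff f α) • (r : ℂ) ^ α.length • adjoint (wordOp S α) y with hz
  have hr : ‖r‖ₑ ^ 2 < 1 := by
    rw [← ofReal_norm, ← ENNReal.ofReal_pow (norm_nonneg _), ENNReal.ofReal_lt_one,
      Real.norm_of_nonneg h0]
    nlinarith
  -- The common factor `(1 - r²)⁻¹` may be cancelled only because it is neither `0` nor `∞`.
  have hc : (1 - ‖r‖ₑ ^ 2)⁻¹ ≠ ⊤ := ENNReal.inv_ne_top.2 (tsub_pos_of_lt hr).ne'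
  have hc0 : (1 - ‖r‖ₑ ^ 2)⁻¹ ≠ 0 :=
    ENNReal.inv_ne_zero.2 (ne_top_of_le_ne_top ENNReal.one_ne_top tsub_le_self)
  have key := tsum_enorm_sq_fock_vector_le f
    (x := fun α => (r : ℂ) ^ α.length • adjoint (wordOp S α) y) (by
      rw [hS.tsum_geometric]
      exact ENNReal.mul_ne_top hc (by simp))
  have hsum : ∀ β : Word d, ∑ α ∈ (coeff f).support, star (coeff f α) •
      ((r : ℂ) ^ (α * β).length • adjoint (wordOp S (α * β)) y) =
      (r : ℂ) ^ β.length • adjoint (wordOp S β) z := by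
    intro β
    simp only [hz, map_sum, Finset.smul_sum, map_smul, adjoint_wordOp_mul_apply,
      FreeMonoid.length_mul, pow_add, mul_smul]
    refine Finset.sum_congr rfl fun α _ => ?_
    rw [smul_comm ((r : ℂ) ^ β.length), smul_comm ((r : ℂ) ^ β.length)]
  simp only [hsum, hS.tsum_geometric] at key
  rw [mul_left_comm, ENNReal.mul_le_mul_iff_right hc0 hc, ← mul_pow,
    ENNReal.pow_le_pow_left_iff two_ne_zero] at key
  simp only [← ofReal_norm, ← ENNReal.ofReal_mul (norm_nonneg _)] at key
  exact (ENNReal.ofReal_le_ofReal_iff (by positivity)).1 key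

/-- **Von Neumann inequality** for Cuntz families. -/
theorem IsCuntzFamily.norm_polyOp_le {S : Fin d → E →L[ℂ] E} (hS : IsCuntzFamily S)
    (f : NCPoly d) : ‖polyOp f S‖ ≤ ‖polyOp f (leftCreation d)‖ := by
  rw [← LinearIsometryEquiv.norm_map adjoint]
  refine opNorm_le_bound _ (norm_nonneg _) fun y => ?_
  rw [adjoint_polyOp_apply]
  have hcont : Continuous fun r : ℝ => ‖∑ α ∈ (coeff f).support,
      star (coeff f α) • (r : ℂ) ^ α.length • adjoint (wordOp S α) y‖ := by fun_prop
  have hlim := (hcont.tendsto 1).mono_left (nhdsWithin_le_nhds (s := Set.Iio 1))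
  simp only [Complex.ofReal_one, one_pow, one_smul] at hlim
  refine le_of_tendsto hlim ?_
  filter_upwards [Ioo_mem_nhdsLT (zero_lt_one (α := ℝ))] with r hr
  exact hS.norm_adjoint_radial_le f hr.1.le hr.2 y

end VonNeumann

/-! ### Moments of random operators -/

section RandomOperators

variable {Ω : Type v} [MeasurableSpace Ω] {μ : Measure Ω} {H : Type u} [NormedAddCommGroup H]
  [InnerProductSpace ℂ H]

/-- A strongly measurable operator-valued function may be applied to a strongly measurable vector
function, whether or not `H` is separable: this holds for simple functions, hence in the limit. -/
theorem aestronglyMeasurable_clm_apply {X : Ω → H →L[ℂ] H}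
    (hX : ∀ u, AEStronglyMeasurable (fun ω => X ω u) μ) {g : Ω → H}
    (hg : AEStronglyMeasurable g μ) : AEStronglyMeasurable (fun ω => X ω (g ω)) μ := by
  have hsimple : ∀ φ : SimpleFunc Ω H, AEStronglyMeasurable (fun ω => X ω (φ ω)) μ := by
    intro φ
    have : (fun ω => X ω (φ ω)) =
        ∑ y ∈ φ.range, (φ ⁻¹' {y}).indicator (fun ω => X ω y) := by
      funext ω
      rw [Finset.sum_apply, Finset.sum_eq_single (φ ω)]
      · simp
      · intro y _ hy
        exact Set.indicator_of_notMem (fun h => hy h.symm) _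
      · exact fun h => absurd (φ.mem_range_self ω) h
    rw [this]
    exact Finset.aestronglyMeasurable_sum _ fun y _ =>
      (hX y).indicator (φ.measurableSet_fiber y)
  have hmk : AEStronglyMeasurable (fun ω => X ω (hg.mk g ω)) μ :=
    aestronglyMeasurable_of_tendsto_ae Filter.atTop
      (fun n => hsimple (hg.stronglyMeasurable_mk.approx n))
      (.of_forall fun ω =>
        ((X ω).continuous.tendsto _).comp (hg.stronglyMeasurable_mk.tendsto_approx ω))
  refine hmk.congr ?_
  filter_upwards [hg.ae_eq_mk] with ω hω
  rw [hω]

theorem IsExpectation.expectation_eq {X : Ω → H →L[ℂ] H} {T : H →L[ℂ] H}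
    (h : IsExpectation μ X T) : expectation μ X = T := by
  have h' : ∃ T : H →L[ℂ] H, IsExpectation μ X T := ⟨T, h⟩
  rw [expectation, dif_pos h']
  ext u
  rw [← (h'.choose_spec u).2, (h u).2]

theorem IsExpectation.smul {X : Ω → H →L[ℂ] H} {T : H →L[ℂ] H} (h : IsExpectation μ X T) (c : ℂ) :
    IsExpectation μ (fun ω => c • X ω) (c • T) := fun u =>
  ⟨(h u).1.smul c, by simp only [smul_apply, integral_smul, (h u).2]⟩

theorem IsExpectation.sum {ι : Type*} (s : Finset ι) {X : ι → Ω → H →L[ℂ] H} {T : ι → H →L[ℂ] H}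
    (h : ∀ i ∈ s, IsExpectation μ (X i) (T i)) :
    IsExpectation μ (fun ω => ∑ i ∈ s, X i ω) (∑ i ∈ s, T i) := fun u => by
  simp only [sum_apply]
  exact ⟨integrable_finsetSum _ fun i hi => (h i hi u).1, by
    rw [integral_finsetSum _ fun i hi => (h i hi u).1]
    exact Finset.sum_congr rfl fun i hi => (h i hi u).2⟩

variable {d : ℕ} {A : Fin d → Ω → H →L[ℂ] H}

/-- Measurability of `ω ↦ ‖A^α(ω)‖`, which strong measurability does not give when `H` is not
separable, comes from the integrability of its square. -/
theorem memLp_norm_wordOp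
    (hA2 : ∀ α : Word d, Integrable (fun ω => ‖wordOp (fun i => A i ω) α‖ ^ 2) μ) (α : Word d) :
    MemLp (fun ω => ‖wordOp (fun i => A i ω) α‖) 2 μ := by
  refine (memLp_two_iff_integrable_sq ?_).2 (hA2 α)
  refine (Real.continuous_sqrt.comp_aestronglyMeasurable (hA2 α).1).congr (.of_forall fun ω => ?_)
  exact Real.sqrt_sq (norm_nonneg _)

variable [CompleteSpace H]

theorem IsExpectation.inner {X : Ω → H →L[ℂ] H} {T : H →L[ℂ] H} (h : IsExpectation μ X T)
    (u v : H) : ⟪u, T v⟫_ℂ = ∫ ω, ⟪u, X ω v⟫_ℂ ∂μ := by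
  rw [← (h v).2, integral_inner (h v).1]

theorem isRandomOperator_wordOp (hA : ∀ i, IsRandomOperator μ (A i)) (α : Word d) :
    IsRandomOperator μ (fun ω => wordOp (fun i => A i ω) α) := by
  induction α using FreeMonoid.inductionOn' with
  | one =>
    simp only [wordOp_one]
    exact ⟨fun u => aestronglyMeasurable_const, fun u => aestronglyMeasurable_const⟩
  | of_mul i α ih =>
    constructor <;> intro u
    · simp only [wordOp_mul, wordOp_of, comp_apply]
      exact aestronglyMeasurable_clm_apply (hA i).apply (ih.apply u)
    · simp only [adjoint_wordOp_mul_apply, wordOp_of]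
      exact aestronglyMeasurable_clm_apply ih.adjoint_apply ((hA i).adjoint_apply u)

theorem memLp_adjoint_wordOp (hA : ∀ i, IsRandomOperator μ (A i))
    (hA2 : ∀ α : Word d, Integrable (fun ω => ‖wordOp (fun i => A i ω) α‖ ^ 2) μ) (α : Word d)
    (u : H) : MemLp (fun ω => adjoint (wordOp (fun i => A i ω) α) u) 2 μ := by
  refine ((memLp_norm_wordOp hA2 α).mul_const ‖u‖).of_le
    ((isRandomOperator_wordOp hA α).adjoint_apply u) (.of_forall fun ω => ?_)
  rw [norm_mul, norm_norm, norm_norm, ← LinearIsometryEquiv.norm_map adjoint]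
  exact le_opNorm _ _

theorem memLp_adjoint_polyOp (hA : ∀ i, IsRandomOperator μ (A i))
    (hA2 : ∀ α : Word d, Integrable (fun ω => ‖wordOp (fun i => A i ω) α‖ ^ 2) μ) (f : NCPoly d)
    (u : H) : MemLp (fun ω => adjoint (polyOp f (fun i => A i ω)) u) 2 μ := by
  simp only [adjoint_polyOp_apply]
  exact memLp_finsetSum _ fun α _ => (memLp_adjoint_wordOp hA hA2 α u).const_smul _

theorem exists_isExpectation_wordOp (hA : ∀ i, IsRandomOperator μ (A i))
    (hA2 : ∀ α : Word d, Integrable (fun ω => ‖wordOp (fun i => A i ω) α‖ ^ 2) μ)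
    (α β : Word d) :
    ∃ T, IsExpectation μ (fun ω => wordOp (fun i => A i ω) α ∘L
      adjoint (wordOp (fun i => A i ω) β)) T := by
  have hint : Integrable (fun ω => ‖wordOp (fun i => A i ω) α‖ * ‖wordOp (fun i => A i ω) β‖) μ :=
    (memLp_norm_wordOp hA2 α).integrable_mul (memLp_norm_wordOp hA2 β)
  have hle : ∀ u ω, ‖wordOp (fun i => A i ω) α (adjoint (wordOp (fun i => A i ω) β) u)‖ ≤
      ‖wordOp (fun i => A i ω) α‖ * ‖wordOp (fun i => A i ω) β‖ * ‖u‖ := by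
    intro u ω
    rw [mul_assoc, ← LinearIsometryEquiv.norm_map adjoint (wordOp (fun i => A i ω) β)]
    exact (le_opNorm _ _).trans (by gcongr; exact le_opNorm _ _)
  have hu : ∀ u, Integrable
      (fun ω => wordOp (fun i => A i ω) α (adjoint (wordOp (fun i => A i ω) β) u)) μ := fun u =>
    (hint.mul_const ‖u‖).mono'
      (aestronglyMeasurable_clm_apply (isRandomOperator_wordOp hA α).apply
        ((isRandomOperator_wordOp hA β).adjoint_apply u)) (.of_forall (hle u))
  refine ⟨LinearMap.mkContinuous
    { toFun := fun u =>
        ∫ ω, wordOp (fun i => A i ω) α (adjoint (wordOp (fun i => A i ω) β) u) ∂μ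
      map_add' := fun u v => by simp only [map_add]; exact integral_add (hu u) (hu v)
      map_smul' := fun c u => by simp only [map_smul, integral_smul, RingHom.id_apply] }
    (∫ ω, ‖wordOp (fun i => A i ω) α‖ * ‖wordOp (fun i => A i ω) β‖ ∂μ) fun u => ?_,
    fun u => ⟨hu u, rfl⟩⟩
  rw [← integral_mul_const]
  exact norm_integral_le_of_norm_le (hint.mul_const ‖u‖) (.of_forall (hle u))

theorem isExpectation_momentKernel (hA : ∀ i, IsRandomOperator μ (A i))
    (hA2 : ∀ α : Word d, Integrable (fun ω => ‖wordOp (fun i => A i ω) α‖ ^ 2) μ)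
    (α β : Word d) :
    IsExpectation μ (fun ω => wordOp (fun i => A i ω) α ∘L
      adjoint (wordOp (fun i => A i ω) β)) (momentKernel μ A α β) := by
  obtain ⟨T, hT⟩ := exists_isExpectation_wordOp hA hA2 α β
  rwa [momentKernel, hT.expectation_eq]

theorem inner_momentKernel (hA : ∀ i, IsRandomOperator μ (A i))
    (hA2 : ∀ α : Word d, Integrable (fun ω => ‖wordOp (fun i => A i ω) α‖ ^ 2) μ)
    (α β : Word d) (u v : H) :
    ⟪u, momentKernel μ A α β v⟫_ℂ = ∫ ω, ⟪adjoint (wordOp (fun i => A i ω) α) u,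
      adjoint (wordOp (fun i => A i ω) β) v⟫_ℂ ∂μ := by
  rw [(isExpectation_momentKernel hA hA2 α β).inner]
  simp only [comp_apply, adjoint_inner_left]

theorem polyOp_comp_adjoint {E : Type w} [NormedAddCommGroup E] [InnerProductSpace ℂ E]
    [CompleteSpace E] (f : NCPoly d) (T : Fin d → E →L[ℂ] E) (P : E →L[ℂ] E) :
    polyOp f T ∘L P ∘L adjoint (polyOp f T) =
      ∑ α ∈ (coeff f).support, ∑ β ∈ (coeff f).support,
        (coeff f α * star (coeff f β)) • (wordOp T α ∘L P ∘L adjoint (wordOp T β)) := by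
  ext x
  simp only [comp_apply, adjoint_polyOp_apply, sum_apply, smul_apply, map_sum, map_smul]
  rw [Finset.sum_comm]
  refine Finset.sum_congr rfl fun β _ => ?_
  rw [polyOp_eq_sum, sum_apply, Finset.smul_sum]
  refine Finset.sum_congr rfl fun α _ => ?_
  rw [smul_apply, smul_smul, mul_comm]

theorem isExpectation_polyOp (hA : ∀ i, IsRandomOperator μ (A i))
    (hA2 : ∀ α : Word d, Integrable (fun ω => ‖wordOp (fun i => A i ω) α‖ ^ 2) μ) (f : NCPoly d) :
    IsExpectation μ (fun ω => polyOp f (fun i => A i ω) ∘L adjoint (polyOp f (fun i => A i ω)))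
      (∑ α ∈ (coeff f).support, ∑ β ∈ (coeff f).support,
        (coeff f α * star (coeff f β)) • momentKernel μ A α β) := by
  have h : ∀ ω, polyOp f (fun i => A i ω) ∘L adjoint (polyOp f (fun i => A i ω)) =
      ∑ α ∈ (coeff f).support, ∑ β ∈ (coeff f).support, (coeff f α * star (coeff f β)) •
        (wordOp (fun i => A i ω) α ∘L adjoint (wordOp (fun i => A i ω) β)) := fun ω => by
    simpa only [id_comp] using
      polyOp_comp_adjoint f (fun i => A i ω) (ContinuousLinearMap.id ℂ H)
  simp only [h]
  exact IsExpectation.sum _ fun α _ => IsExpectation.sum _ fun β _ =>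
    (isExpectation_momentKernel hA hA2 α β).smul _

theorem inner_expectation_polyOp (hA : ∀ i, IsRandomOperator μ (A i))
    (hA2 : ∀ α : Word d, Integrable (fun ω => ‖wordOp (fun i => A i ω) α‖ ^ 2) μ) (f : NCPoly d)
    (u : H) :
    ⟪u, (∑ α ∈ (coeff f).support, ∑ β ∈ (coeff f).support,
        (coeff f α * star (coeff f β)) • momentKernel μ A α β) u⟫_ℂ =
      ((∫ ω, ‖adjoint (polyOp f (fun i => A i ω)) u‖ ^ 2 ∂μ : ℝ) : ℂ) := by
  rw [(isExpectation_polyOp hA hA2 f).inner, ← integral_complex_ofReal]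
  refine integral_congr_ae (.of_forall fun ω => ?_)
  simp only [comp_apply]
  rw [← adjoint_inner_left, inner_self_eq_norm_sq_to_K]
  simp

end RandomOperators

/-! ### The bound by a given dilation -/

section Bound

variable {Ω : Type v} [MeasurableSpace Ω] {μ : Measure Ω} {H : Type u} [NormedAddCommGroup H]
  [InnerProductSpace ℂ H] [CompleteSpace H] {d : ℕ} {A : Fin d → Ω → H →L[ℂ] H}
  {E : Type w} [NormedAddCommGroup E] [InnerProductSpace ℂ E] [CompleteSpace E]

theorem inner_starProjection_apply {P : E →L[ℂ] E} (hP : IsStarProjection P) (y : E) :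
    ⟪y, P y⟫_ℂ = ⟪P y, P y⟫_ℂ := by
  have h : adjoint P = P := hP.isSelfAdjoint
  have h2 : P (P y) = P y := congrArg (fun B : E →L[ℂ] E => B y) hP.isIdempotentElem
  rw [← adjoint_inner_right, h, h2]

theorem norm_starProjection_apply_le {P : E →L[ℂ] E} (hP : IsStarProjection P) (y : E) :
    ‖P y‖ ≤ ‖y‖ := by
  have h : ‖P y‖ * ‖P y‖ ≤ ‖y‖ * ‖P y‖ := by
    rw [← inner_self_eq_norm_mul_norm (𝕜 := ℂ), ← inner_starProjection_apply hP]
    exact re_inner_le_norm _ _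
  rcases (norm_nonneg (P y)).eq_or_lt with h0 | h0
  · rw [← h0]; exact norm_nonneg y
  · exact le_of_mul_le_mul_right h h0

/-- Every dilation compresses `E[f(A) f(A)^*]` to `W^* f(S) P f(S)^* W`. -/
theorem integral_norm_sq_eq (hA : ∀ i, IsRandomOperator μ (A i))
    (hA2 : ∀ α : Word d, Integrable (fun ω => ‖wordOp (fun i => A i ω) α‖ ^ 2) μ)
    {S : Fin d → E →L[ℂ] E} {P : E →L[ℂ] E} {W : H →ₗᵢ[ℂ] E}
    (h : IsDilation (momentKernel μ A) S P W) (f : NCPoly d) (u : H) :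
    ∫ ω, ‖adjoint (polyOp f (fun i => A i ω)) u‖ ^ 2 ∂μ =
      ‖P (adjoint (polyOp f S) (W u))‖ ^ 2 := by
  have h1 := inner_expectation_polyOp hA hA2 f u
  have h2 : (∑ α ∈ (coeff f).support, ∑ β ∈ (coeff f).support,
      (coeff f α * star (coeff f β)) • momentKernel μ A α β) =
      adjoint W.toContinuousLinearMap ∘L (polyOp f S ∘L P ∘L adjoint (polyOp f S)) ∘L
        W.toContinuousLinearMap := by
    ext x
    simp only [polyOp_comp_adjoint, h.kernel_eq, sum_apply, smul_apply, comp_apply, map_sum,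
      map_smul]
  rw [h2] at h1
  simp only [comp_apply] at h1
  rw [adjoint_inner_right, ← adjoint_inner_left, LinearIsometry.coe_toContinuousLinearMap,
    inner_starProjection_apply h.proj, inner_self_eq_norm_sq_to_K] at h1
  refine Complex.ofReal_injective ?_
  rw [← h1]
  simp

theorem integral_norm_sq_le (hA : ∀ i, IsRandomOperator μ (A i))
    (hA2 : ∀ α : Word d, Integrable (fun ω => ‖wordOp (fun i => A i ω) α‖ ^ 2) μ)
    {S : Fin d → E →L[ℂ] E} {P : E →L[ℂ] E} {W : H →ₗᵢ[ℂ] E}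
    (h : IsDilation (momentKernel μ A) S P W) (f : NCPoly d) (u : H) :
    ∫ ω, ‖adjoint (polyOp f (fun i => A i ω)) u‖ ^ 2 ∂μ ≤ ‖polyOp f S‖ ^ 2 * ‖u‖ ^ 2 := by
  rw [integral_norm_sq_eq hA hA2 h, ← mul_pow]
  gcongr
  refine (norm_starProjection_apply_le h.proj _).trans ((le_opNorm _ _).trans ?_)
  rw [LinearIsometryEquiv.norm_map, LinearIsometry.norm_map]

end Bound

/-! ### Vector-valued Fock spaces -/

section VectorFock

variable {d : ℕ}

/-- The full Fock space with values in `N`, that is `ℓ²(𝔽_d^+) ⊗ N`. -/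
abbrev VectorFock (d : ℕ) (N : Type u) [NormedAddCommGroup N] : Type u :=
  lp (fun _ : Word d => N) 2

/-- The function with value `x v` at the word `i v` and `0` at all words not starting with `i`,
for functions with values in any additive group. -/
noncomputable def vectorShift {G : Type*} [Zero G] (i : Fin d) (x : Word d → G) : Word d → G :=
  Function.extend (fun v : Word d => FreeMonoid.of i * v) x 0

theorem vectorShift_one {G : Type*} [Zero G] (i : Fin d) (x : Word d → G) :
    vectorShift i x 1 = 0 := by
  rw [vectorShift, Function.extend_apply' _ _ _ ?_]
  · rfl
  · rintro ⟨t, ht⟩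
    exact absurd (congrArg FreeMonoid.length ht) (by simp)

theorem vectorShift_of_mul {G : Type*} [Zero G] (i j : Fin d) (x : Word d → G) (v : Word d) :
    vectorShift i x (FreeMonoid.of j * v) = if i = j then x v else 0 := by
  split_ifs with h
  · subst h
    rw [vectorShift, (of_mul_injective i).extend_apply]
  · rw [vectorShift, Function.extend_apply' _ _ _ ?_]
    · rfl
    · rintro ⟨t, ht⟩
      exact h (List.cons.inj ht).1

theorem norm_vectorShift_rpow {G : Type*} [NormedAddCommGroup G] (i : Fin d) (x : Word d → G) :
    (fun v => ‖vectorShift i x v‖ ^ (2 : ENNReal).toReal) =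
      vectorShift i (fun v => ‖x v‖ ^ (2 : ENNReal).toReal) := by
  funext v
  induction v using FreeMonoid.casesOn with
  | one => simp [vectorShift_one]
  | of_mul j v => by_cases h : i = j <;> simp [vectorShift_of_mul, h]

theorem memℓp_vectorShift {G : Type*} [NormedAddCommGroup G] (i : Fin d) (x : VectorFock d G) :
    Memℓp (vectorShift i x) 2 := by
  apply memℓp_gen
  rw [norm_vectorShift_rpow]
  exact (summable_extend_zero (of_mul_injective i)).2 (x.2.summable (by simp))

variable {N : Type u} [NormedAddCommGroup N] [InnerProductSpace ℂ N]

/-- The left creation operator `Lᵢ ⊗ I` on the `N`-valued Fock space. -/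
noncomputable def creation (i : Fin d) : VectorFock d N →ₗᵢ[ℂ] VectorFock d N where
  toFun x := ⟨vectorShift i x, memℓp_vectorShift i x⟩
  map_add' x y := by
    ext v
    change vectorShift i (⇑x + ⇑y) v = vectorShift i x v + vectorShift i y v
    induction v using FreeMonoid.casesOn with
    | one => simp [vectorShift_one]
    | of_mul j v => by_cases h : i = j <;> simp [vectorShift_of_mul, h]
  map_smul' c x := by
    ext v
    change vectorShift i (c • ⇑x) v = c • vectorShift i x v
    induction v using FreeMonoid.casesOn with
    | one => simp [vectorShift_one]
    | of_mul j v => by_cases h : i = j <;> simp [vectorShift_of_mul, h]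
  norm_map' x := by
    have h2 : 0 < (2 : ENNReal).toReal := by simp
    rw [lp.norm_eq_tsum_rpow h2, lp.norm_eq_tsum_rpow h2 x]
    congr 1
    change ∑' v, ‖vectorShift i x v‖ ^ (2 : ENNReal).toReal = _
    rw [norm_vectorShift_rpow, vectorShift, tsum_extend_zero (of_mul_injective i)]

theorem creation_apply_one (i : Fin d) (x : VectorFock d N) : creation i x 1 = 0 :=
  vectorShift_one i x

theorem creation_apply_of_mul (i j : Fin d) (x : VectorFock d N) (v : Word d) :
    creation i x (FreeMonoid.of j * v) = if i = j then x v else 0 :=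
  vectorShift_of_mul i j x v

open scoped Classical in
/-- The embedding `n ↦ e_∅ ⊗ n` of `N` into the `N`-valued Fock space. -/
noncomputable def vacuum (d : ℕ) (N : Type u) [NormedAddCommGroup N] [InnerProductSpace ℂ N] :
    N →ₗᵢ[ℂ] VectorFock d N where
  toLinearMap := lp.lsingle (𝕜 := ℂ) (E := fun _ : Word d => N) 2 1
  norm_map' n := lp.norm_single (by simp) _ _

theorem vacuum_apply_one (n : N) : vacuum d N n 1 = n := by
  classical
  exact lp.single_apply_self _ _ _

theorem vacuum_apply_of_mul (n : N) (i : Fin d) (v : Word d) :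
    vacuum d N n (FreeMonoid.of i * v) = 0 := by
  classical
  refine lp.single_apply_ne _ _ _ fun h => ?_
  exact absurd (congrArg FreeMonoid.length h) (by simp)

open scoped Classical in
theorem creation_single (i : Fin d) (β : Word d) (n : N) :
    creation i (lp.single 2 β n) = (lp.single 2 (FreeMonoid.of i * β) n : VectorFock d N) := by
  ext v
  induction v using FreeMonoid.casesOn with
  | one =>
    rw [creation_apply_one, lp.single_apply_ne]
    intro h
    have := congrArg FreeMonoid.length h
    simp only [FreeMonoid.length_one, FreeMonoid.length_mul, FreeMonoid.length_of] at this
    omega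
  | of_mul j v =>
    rw [creation_apply_of_mul]
    by_cases hij : i = j
    · subst hij
      simp [Pi.single_apply]
    · rw [if_neg hij, lp.single_apply_ne]
      exact fun h => hij (List.cons.inj h).1.symm

variable [CompleteSpace N]

theorem adjoint_creation_apply (i : Fin d) (x : VectorFock d N) (β : Word d) :
    adjoint (creation i).toContinuousLinearMap x β = x (FreeMonoid.of i * β) := by
  classical
  refine ext_inner_left ℂ fun n => ?_
  have h := lp.inner_single_left (𝕜 := ℂ) β n (adjoint (creation i).toContinuousLinearMap x)
  rw [adjoint_inner_right, LinearIsometry.coe_toContinuousLinearMap, creation_single,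
    lp.inner_single_left] at h
  exact h.symm

theorem adjoint_vacuum_apply (x : VectorFock d N) :
    adjoint (vacuum d N).toContinuousLinearMap x = x 1 := by
  classical
  refine ext_inner_left ℂ fun n => ?_
  rw [adjoint_inner_right]
  exact lp.inner_single_left (𝕜 := ℂ) 1 n x

theorem adjoint_isometry_apply {E : Type u} {F : Type w} [NormedAddCommGroup E]
    [InnerProductSpace ℂ E] [CompleteSpace E] [NormedAddCommGroup F] [InnerProductSpace ℂ F]
    [CompleteSpace F] (J : E →ₗᵢ[ℂ] F) (x : E) : adjoint J.toContinuousLinearMap (J x) = x := by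
  refine ext_inner_left ℂ fun y => ?_
  rw [adjoint_inner_right, LinearIsometry.coe_toContinuousLinearMap, J.inner_map_map]

theorem adjoint_creation_creation (i j : Fin d) (x : VectorFock d N) :
    adjoint (creation i).toContinuousLinearMap (creation j x) = if j = i then x else 0 := by
  ext v
  rw [adjoint_creation_apply, creation_apply_of_mul]
  split_ifs <;> rfl

theorem adjoint_creation_vacuum (i : Fin d) (n : N) :
    adjoint (creation i).toContinuousLinearMap (vacuum d N n) = 0 := by
  ext v
  rw [adjoint_creation_apply, vacuum_apply_of_mul]
  rfl

theorem adjoint_vacuum_creation (i : Fin d) (x : VectorFock d N) :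
    adjoint (vacuum d N).toContinuousLinearMap (creation i x) = 0 := by
  rw [adjoint_vacuum_apply, creation_apply_one]

/-- The vacuum and the ranges of the creation operators span the Fock space. -/
theorem vacuum_add_sum_creation (x : VectorFock d N) :
    vacuum d N (adjoint (vacuum d N).toContinuousLinearMap x) +
      ∑ i, creation i (adjoint (creation i).toContinuousLinearMap x) = x := by
  ext v
  rw [lp.coeFn_add, Pi.add_apply, lp.coeFn_sum, Finset.sum_apply]
  induction v using FreeMonoid.casesOn with
  | one => simp [vacuum_apply_one, adjoint_vacuum_apply, creation_apply_one]
  | of_mul j v =>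
    simp [vacuum_apply_of_mul, creation_apply_of_mul, adjoint_creation_apply]

theorem norm_sq_vacuum_add_sum_creation (x : VectorFock d N) :
    ‖adjoint (vacuum d N).toContinuousLinearMap x‖ ^ 2 +
      ∑ i, ‖adjoint (creation i).toContinuousLinearMap x‖ ^ 2 = ‖x‖ ^ 2 := by
  have h : ⟪vacuum d N (adjoint (vacuum d N).toContinuousLinearMap x) +
      ∑ i, creation i (adjoint (creation i).toContinuousLinearMap x), x⟫_ℂ = ⟪x, x⟫_ℂ := by
    rw [vacuum_add_sum_creation]
  rw [inner_add_left, sum_inner] at h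
  simp only [← LinearIsometry.coe_toContinuousLinearMap, ← adjoint_inner_right,
    inner_self_eq_norm_sq_to_K] at h
  exact_mod_cast h

end VectorFock

/-! ### Dilation of row contractions to Cuntz families -/

section Extension

variable {d : ℕ}

/-- If the column `y ↦ (Rᵢ y)ᵢ` is a unitary from `E` onto `E^d`, then the adjoints `Rᵢ^*` form a
Cuntz family. -/
theorem isCuntzFamily_adjoint_of_unitary_column {E : Type u} [NormedAddCommGroup E]
    [InnerProductSpace ℂ E] [CompleteSpace E] {R : Fin d → E →L[ℂ] E}
    (hnorm : ∀ y, ∑ i, ‖R i y‖ ^ 2 = ‖y‖ ^ 2) (hsurj : ∀ y : Fin d → E, ∃ z, ∀ i, R i z = y i) :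
    IsCuntzFamily (fun i => adjoint (R i)) := by
  have hsum : ∑ i, adjoint (R i) ∘L R i = ContinuousLinearMap.id ℂ E := by
    refine ContinuousLinearMap.coe_injective ((ext_inner_map _ _).1 fun y => ?_)
    simp only [coe_coe, sum_apply, comp_apply, sum_inner, adjoint_inner_left, id_apply,
      inner_self_eq_norm_sq_to_K]
    exact_mod_cast hnorm y
  refine ⟨fun i j => ?_, by simpa only [adjoint_adjoint] using hsum⟩
  ext y
  obtain ⟨z, hz⟩ := hsurj (Pi.single j y)
  -- As `z` is sent to `y` in position `j` of the column, the identity `∑ Rᵢ^* Rᵢ = I` recovers it.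
  have hz' : adjoint (R j) y = z := by
    have h := congrArg (fun B : E →L[ℂ] E => B z) hsum
    simp only [sum_apply, comp_apply, id_apply, hz] at h
    rw [Finset.sum_eq_single j (fun i _ hij => by rw [Pi.single_eq_of_ne hij, map_zero])
      (by simp), Pi.single_eq_same] at h
    exact h
  rw [adjoint_adjoint, comp_apply, hz', hz i]
  by_cases hij : i = j
  · subst hij; simp
  · simp [hij]

/-- An isometric column `a ↦ (Bᵢ a)ᵢ` extends to the unitary column of a Cuntz family: on
`F ⊕ (ℓ²(𝔽_d^+) ⊗ N)`, where `N` is the orthogonal complement of the range of the column, the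
vacuum `e_∅ ⊗ N` fills up the missing range. -/
theorem exists_cuntzFamily_of_isometric_column {F : Type u} [NormedAddCommGroup F]
    [InnerProductSpace ℂ F] [CompleteSpace F] {B : Fin d → F →L[ℂ] F}
    (hB : ∀ a, ∑ i, ‖B i a‖ ^ 2 = ‖a‖ ^ 2) :
    ∃ (E : Type u) (_ : NormedAddCommGroup E) (_ : InnerProductSpace ℂ E) (_ : CompleteSpace E)
      (S : Fin d → E →L[ℂ] E) (J : F →ₗᵢ[ℂ] E), IsCuntzFamily S ∧
        ∀ i a, adjoint (S i) (J a) = J (B i a) := by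
  let U : F →ₗᵢ[ℂ] PiLp 2 (fun _ : Fin d => F) :=
    { toFun := fun a => WithLp.toLp 2 fun i => B i a
      map_add' := fun a b => by ext i; simp
      map_smul' := fun c a => by ext i; simp
      norm_map' := fun a => by
        have h := PiLp.norm_sq_eq_of_L2 (fun _ : Fin d => F) (WithLp.toLp 2 fun i => B i a)
        simp only [hB] at h
        exact (pow_left_inj₀ (norm_nonneg _) (norm_nonneg _) two_ne_zero).1 h }
  let N : Submodule ℂ (PiLp 2 (fun _ : Fin d => F)) := (LinearMap.range U.toLinearMap)ᗮ
  have hcl : IsClosed (LinearMap.range U.toLinearMap : Set (PiLp 2 (fun _ : Fin d => F))) :=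
    U.isometry.isClosedEmbedding.isClosed_range
  have : CompleteSpace (LinearMap.range U.toLinearMap) := hcl.completeSpace_coe
  let J := (vacuum d N).toContinuousLinearMap
  let R : Fin d → WithLp 2 (F × VectorFock d N) →L[ℂ] WithLp 2 (F × VectorFock d N) := fun i =>
    (WithLp.prodContinuousLinearEquiv 2 ℂ F (VectorFock d N)).symm.toContinuousLinearMap ∘L
      ((PiLp.proj 2 (fun _ : Fin d => F) i ∘L (U.toContinuousLinearMap ∘L fst ℂ _ _ +
          N.subtypeL ∘L adjoint J ∘L snd ℂ _ _)).prod
        (adjoint (creation i).toContinuousLinearMap ∘L snd ℂ _ _)) ∘L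
      (WithLp.prodContinuousLinearEquiv 2 ℂ F (VectorFock d N)).toContinuousLinearMap
  have hR : ∀ i y, R i y = WithLp.toLp 2 ((U y.fst + (adjoint J y.snd : N)) i,
      adjoint (creation i).toContinuousLinearMap y.snd) := fun i y => rfl
  have hnorm : ∀ y, ∑ i, ‖R i y‖ ^ 2 = ‖y‖ ^ 2 := by
    intro y
    have horth : ⟪U y.fst, ((adjoint J y.snd : N) : PiLp 2 (fun _ : Fin d => F))⟫_ℂ = 0 :=
      Submodule.inner_right_of_mem_orthogonal (LinearMap.mem_range_self U.toLinearMap y.fst)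
        (adjoint J y.snd).2
    have hp := norm_add_sq_eq_norm_sq_add_norm_sq_of_inner_eq_zero _ _ horth
    simp only [← pow_two, U.norm_map] at hp
    have hRn : ∀ i, ‖R i y‖ ^ 2 = ‖(U y.fst + (adjoint J y.snd : N)) i‖ ^ 2 +
        ‖adjoint (creation i).toContinuousLinearMap y.snd‖ ^ 2 := fun i => by
      rw [hR, WithLp.prod_norm_sq_eq_of_L2]
      rfl
    simp only [hRn, Finset.sum_add_distrib]
    rw [← PiLp.norm_sq_eq_of_L2, hp, WithLp.prod_norm_sq_eq_of_L2,
      ← norm_sq_vacuum_add_sum_creation y.snd, ← add_assoc]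
    rfl
  have hsurj : ∀ y : Fin d → WithLp 2 (F × VectorFock d N), ∃ z, ∀ i, R i z = y i := by
    intro y
    obtain ⟨_, ⟨a, rfl⟩, n, hn, hb⟩ :=
      (LinearMap.range U.toLinearMap).exists_add_mem_mem_orthogonal
        (WithLp.toLp 2 fun i => (y i).fst)
    refine ⟨WithLp.toLp 2 (a, J ⟨n, hn⟩ + ∑ j, creation j (y j).snd), fun i => ?_⟩
    have h1 : adjoint J (J ⟨n, hn⟩ + ∑ j, creation j (y j).snd) = ⟨n, hn⟩ := by
      simp only [J, map_add, map_sum, adjoint_vacuum_creation, Finset.sum_const_zero, add_zero]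
      exact adjoint_isometry_apply (vacuum d N) _
    have h2 : adjoint (creation i).toContinuousLinearMap
        (J ⟨n, hn⟩ + ∑ j, creation j (y j).snd) = (y i).snd := by
      simp only [J, map_add, map_sum, adjoint_creation_creation,
        LinearIsometry.coe_toContinuousLinearMap, adjoint_creation_vacuum, zero_add]
      simp
    have h3 : (U a + n) i = (y i).fst :=
      (congrArg (fun x : PiLp 2 (fun _ : Fin d => F) => x i) hb).symm
    refine congrArg (WithLp.toLp 2) (Prod.ext ?_ h2)
    change (U a + (adjoint J (J ⟨n, hn⟩ + ∑ j, creation j (y j).snd) : N)) i = (y i).fst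
    rw [h1]
    exact h3
  have hext : ∀ i a, adjoint (adjoint (R i)) (WithLp.toLp 2 (a, 0)) = WithLp.toLp 2 (B i a, 0) := by
    intro i a
    have h1 : (U a + (adjoint J 0 : N)) i = B i a := by
      rw [map_zero, ZeroMemClass.coe_zero, add_zero]
      rfl
    rw [adjoint_adjoint, hR]
    exact congrArg (WithLp.toLp 2) (Prod.ext h1 (map_zero _))
  refine ⟨WithLp 2 (F × VectorFock d N), inferInstance, inferInstance, inferInstance,
    fun i => adjoint (R i),
    { toFun := fun a => WithLp.toLp 2 (a, 0)
      map_add' := fun a b => by rw [← WithLp.toLp_add, Prod.mk_add_mk, add_zero]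
      map_smul' := fun c a => by
        rw [RingHom.id_apply, ← WithLp.toLp_smul, Prod.smul_mk, smul_zero]
      norm_map' := fun a => by simp },
    isCuntzFamily_adjoint_of_unitary_column hnorm hsurj, hext⟩

/-- The defect operator `(I - ∑ Tᵢ^* Tᵢ)^{1/2}` of a contractive column. -/
theorem exists_defect {M : Type u} [NormedAddCommGroup M] [InnerProductSpace ℂ M]
    [CompleteSpace M] {T : Fin d → M →L[ℂ] M} (hT : ∀ x, ∑ i, ‖T i x‖ ^ 2 ≤ ‖x‖ ^ 2) :
    ∃ D : M →L[ℂ] M, ∀ x, ∑ i, ‖T i x‖ ^ 2 + ‖D x‖ ^ 2 = ‖x‖ ^ 2 := by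
  let Q : M →L[ℂ] M := ContinuousLinearMap.id ℂ M - ∑ i, adjoint (T i) ∘L T i
  have hQx : ∀ x, ⟪x, Q x⟫_ℂ = ((‖x‖ ^ 2 - ∑ i, ‖T i x‖ ^ 2 : ℝ) : ℂ) := by
    intro x
    simp only [Q, sub_apply, id_apply, sum_apply, comp_apply, inner_sub_right, inner_sum,
      adjoint_inner_right, inner_self_eq_norm_sq_to_K]
    push_cast
    rfl
  have hQ : 0 ≤ Q := by
    rw [nonneg_iff_isPositive, isPositive_iff_complex]
    intro x
    rw [← inner_conj_symm, hQx, Complex.conj_ofReal]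
    exact ⟨rfl, sub_nonneg.2 (hT x)⟩
  refine ⟨CFC.sqrt Q, fun x => ?_⟩
  have hD : adjoint (CFC.sqrt Q) = CFC.sqrt Q :=
    (IsSelfAdjoint.of_nonneg (CFC.sqrt_nonneg Q))
  have h2 : CFC.sqrt Q (CFC.sqrt Q x) = Q x :=
    congrArg (fun B : M →L[ℂ] M => B x) (CFC.sqrt_mul_sqrt_self Q hQ)
  have h : ((‖CFC.sqrt Q x‖ ^ 2 : ℝ) : ℂ) = ((‖x‖ ^ 2 - ∑ i, ‖T i x‖ ^ 2 : ℝ) : ℂ) := by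
    rw [← hQx, ← h2]
    conv_rhs => rw [← hD, adjoint_inner_right]
    rw [hD, inner_self_eq_norm_sq_to_K]
    simp
  rw [Complex.ofReal_injective h]
  ring

/-- A contractive column `T` lifts to an isometric column `B`, for which `J^* Bᵢ = Tᵢ J^*`; the
defect of `T` is sent into the range of one creation operator. -/
theorem exists_isometric_column {M : Type u} [NormedAddCommGroup M] [InnerProductSpace ℂ M]
    [CompleteSpace M] (i₀ : Fin d) {T : Fin d → M →L[ℂ] M}
    (hT : ∀ x, ∑ i, ‖T i x‖ ^ 2 ≤ ‖x‖ ^ 2) :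
    ∃ (F : Type u) (_ : NormedAddCommGroup F) (_ : InnerProductSpace ℂ F) (_ : CompleteSpace F)
      (B : Fin d → F →L[ℂ] F) (J : M →ₗᵢ[ℂ] F), (∀ a, ∑ i, ‖B i a‖ ^ 2 = ‖a‖ ^ 2) ∧
        ∀ i a, adjoint J.toContinuousLinearMap (B i a) =
          T i (adjoint J.toContinuousLinearMap a) := by
  obtain ⟨D, hD⟩ := exists_defect hT
  let J := vacuum d M
  let J' : VectorFock d M →L[ℂ] M := adjoint J.toContinuousLinearMap
  -- `C` applies the defect operator to the vacuum component and keeps the other components.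
  let C : VectorFock d M →L[ℂ] VectorFock d M :=
    J.toContinuousLinearMap ∘L D ∘L J' +
      (ContinuousLinearMap.id ℂ _ - J.toContinuousLinearMap ∘L J')
  let B : Fin d → VectorFock d M →L[ℂ] VectorFock d M := fun i =>
    J.toContinuousLinearMap ∘L T i ∘L J' +
      if i = i₀ then (creation i₀).toContinuousLinearMap ∘L C else 0
  have hJJ : ∀ x, J' (J x) = x := adjoint_isometry_apply J
  have hJC : ∀ i x, J' (creation i x) = 0 := adjoint_vacuum_creation
  have horth : ∀ (m : M) (x : VectorFock d M), J' x = 0 → ‖J m + x‖ ^ 2 = ‖m‖ ^ 2 + ‖x‖ ^ 2 := by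
    intro m x hx
    have h0 : ⟪J m, x⟫_ℂ = 0 := by
      rw [← LinearIsometry.coe_toContinuousLinearMap, ← adjoint_inner_right]
      change ⟪m, J' x⟫_ℂ = 0
      rw [hx, inner_zero_right]
    have h := norm_add_sq_eq_norm_sq_add_norm_sq_of_inner_eq_zero _ _ h0
    simpa only [← pow_two, J.norm_map] using h
  have hCnorm : ∀ a, ‖C a‖ ^ 2 = ‖D (J' a)‖ ^ 2 + (‖a‖ ^ 2 - ‖J' a‖ ^ 2) := by
    intro a
    have hker : J' (a - J (J' a)) = 0 := by rw [map_sub, hJJ, sub_self]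
    have h1 : C a = J (D (J' a)) + (a - J (J' a)) := rfl
    have h2 := horth (J' a) _ hker
    rw [add_sub_cancel] at h2
    rw [h1, horth _ _ hker, h2]
    ring
  have hBapp : ∀ i a, B i a = J (T i (J' a)) + if i = i₀ then creation i₀ (C a) else 0 := by
    intro i a
    by_cases h : i = i₀ <;> simp [B, h]
  refine ⟨VectorFock d M, inferInstance, inferInstance, inferInstance, B, J, fun a => ?_,
    fun i a => ?_⟩
  · have h : ∀ i, ‖B i a‖ ^ 2 = ‖T i (J' a)‖ ^ 2 + if i = i₀ then ‖C a‖ ^ 2 else 0 := by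
      intro i
      rw [hBapp, horth]
      · split_ifs <;> simp
      · split_ifs
        · exact hJC _ _
        · exact map_zero _
    simp only [h, Finset.sum_add_distrib, Finset.sum_ite_eq', Finset.mem_univ, if_true]
    rw [hCnorm]
    linarith [hD (J' a)]
  · change J' (B i a) = T i (J' a)
    rw [hBapp, map_add, hJJ]
    split_ifs
    · rw [hJC, add_zero]
    · rw [map_zero, add_zero]

/-- A map that intertwines the adjoints of two tuples intertwines those of all words. -/
theorem adjoint_wordOp_intertwine {E : Type u} {F : Type v} [NormedAddCommGroup E]
    [InnerProductSpace ℂ E] [CompleteSpace E] [NormedAddCommGroup F] [InnerProductSpace ℂ F]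
    [CompleteSpace F] {T : Fin d → E →L[ℂ] E} {S : Fin d → F →L[ℂ] F} {X : E → F}
    (h : ∀ i x, adjoint (S i) (X x) = X (adjoint (T i) x)) (α : Word d) (x : E) :
    adjoint (wordOp S α) (X x) = X (adjoint (wordOp T α) x) := by
  induction α using FreeMonoid.inductionOn' generalizing x with
  | one => simp only [adjoint_wordOp_one_apply]
  | of_mul i α ih => simp only [adjoint_wordOp_mul_apply, wordOp_of, h, ih]

/-- A kernel of the form `W₀^* V^α (V^β)^* W₀` with a row contraction `V` has a dilation. The
projection `P` is the one onto the space of `V`. -/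
theorem exists_isDilation_of_rowContraction {M H : Type u} [NormedAddCommGroup M]
    [InnerProductSpace ℂ M] [CompleteSpace M] [NormedAddCommGroup H] [InnerProductSpace ℂ H]
    [CompleteSpace H] (i₀ : Fin d) {V : Fin d → M →L[ℂ] M}
    (hV : ∀ x, ∑ i, ‖adjoint (V i) x‖ ^ 2 ≤ ‖x‖ ^ 2) (W₀ : H →ₗᵢ[ℂ] M)
    {K : Word d → Word d → H →L[ℂ] H}
    (hK : ∀ α β u v, ⟪u, K α β v⟫_ℂ =
      ⟪adjoint (wordOp V α) (W₀ u), adjoint (wordOp V β) (W₀ v)⟫_ℂ) :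
    ∃ (E : Type u) (_ : NormedAddCommGroup E) (_ : InnerProductSpace ℂ E) (_ : CompleteSpace E)
      (S : Fin d → E →L[ℂ] E) (P : E →L[ℂ] E) (W : H →ₗᵢ[ℂ] E), IsDilation K S P W := by
  obtain ⟨F, _, _, _, B, J₀, hB, hJ₀⟩ := exists_isometric_column i₀ hV
  obtain ⟨E, _, _, _, S, J, hS, hJ⟩ := exists_cuntzFamily_of_isometric_column hB
  let J₁ : M →ₗᵢ[ℂ] E := J.comp J₀
  let P : E →L[ℂ] E := J₁.toContinuousLinearMap ∘L adjoint J₁.toContinuousLinearMap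
  let J₀' : F →L[ℂ] M := adjoint J₀.toContinuousLinearMap
  have hPJ : ∀ a, P (J a) = J₁ (J₀' a) := by
    intro a
    have : adjoint J₁.toContinuousLinearMap (J a) = J₀' a := by
      refine ext_inner_left ℂ fun m => ?_
      rw [adjoint_inner_right, adjoint_inner_right]
      exact J.inner_map_map _ _
    simp only [P, comp_apply, this, LinearIsometry.coe_toContinuousLinearMap]
  have hproj : IsStarProjection P := by
    refine ⟨?_, ?_⟩
    · ext y
      exact congrArg J₁ (adjoint_isometry_apply J₁ _)
    · change adjoint P = P
      simp only [P, adjoint_comp, adjoint_adjoint]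
  have hSJ : ∀ α a, adjoint (wordOp S α) (J a) =
      J (adjoint (wordOp (fun i => adjoint (B i)) α) a) :=
    adjoint_wordOp_intertwine fun i a => by rw [adjoint_adjoint, hJ]
  have hVJ : ∀ α a, adjoint (wordOp V α) (J₀' a) =
      J₀' (adjoint (wordOp (fun i => adjoint (B i)) α) a) :=
    adjoint_wordOp_intertwine fun i a => by rw [adjoint_adjoint]; exact (hJ₀ i a).symm
  have hPS : ∀ α m, P (adjoint (wordOp S α) (J₁ m)) = J₁ (adjoint (wordOp V α) m) := by
    intro α m
    have h1 : J₀' (J₀ m) = m := adjoint_isometry_apply J₀ m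
    change P (adjoint (wordOp S α) (J (J₀ m))) = _
    rw [hSJ, hPJ, ← hVJ, h1]
  refine ⟨E, inferInstance, inferInstance, inferInstance, S, P, J₁.comp W₀, hS, hproj,
    fun α β => ?_, fun y hy => ?_⟩
  · ext v
    refine ext_inner_left ℂ fun u => ?_
    simp only [comp_apply]
    rw [hK, adjoint_inner_right (J₁.comp W₀).toContinuousLinearMap,
      ← adjoint_inner_left (wordOp S α)]
    change _ = ⟪adjoint (wordOp S α) (J₁ (W₀ u)), P (adjoint (wordOp S β) (J₁ (W₀ v)))⟫_ℂ
    have hPP : ∀ x, P (P x) = P x := fun x =>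
      congrArg (fun B : E →L[ℂ] E => B x) hproj.isIdempotentElem
    have hPa : adjoint P = P := hproj.isSelfAdjoint
    rw [← hPP, ← adjoint_inner_left P, hPa, hPS, hPS, J₁.inner_map_map]
  · have hcl : IsClosed (LinearMap.range J.toLinearMap : Set E) :=
      J.isometry.isClosedEmbedding.isClosed_range
    -- On all of `E` the inequality may fail, but the cyclic space lies in the space of `B`.
    have hle : cyclicSpace S (J₁.comp W₀) ≤ LinearMap.range J.toLinearMap := by
      refine Submodule.topologicalClosure_minimal _ (Submodule.span_le.2 ?_) hcl
      rintro _ ⟨γ, u, rfl⟩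
      exact ⟨_, (hSJ γ (J₀ (W₀ u))).symm⟩
    obtain ⟨a, rfl⟩ := hle hy
    change (⟪J a, (∑ i, S i ∘L P ∘L adjoint (S i)) (J a)⟫_ℂ).re ≤ (⟪J a, P (J a)⟫_ℂ).re
    have hterm : ∀ i, P (J (B i a)) = J₁ (adjoint (V i) (J₀' a)) := fun i => by
      rw [hPJ]
      exact congrArg J₁ (hJ₀ i a)
    have hquad : ∀ y, (⟪y, P y⟫_ℂ).re = ‖P y‖ ^ 2 := fun y => by
      rw [inner_starProjection_apply hproj]
      exact inner_self_eq_norm_sq (𝕜 := ℂ) (P y)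
    have hsum : (⟪J a, (∑ i, S i ∘L P ∘L adjoint (S i)) (J a)⟫_ℂ).re =
        ∑ i, (⟪J (B i a), P (J (B i a))⟫_ℂ).re := by
      simp only [sum_apply, comp_apply, inner_sum, Complex.re_sum, ← hJ, adjoint_inner_left]
    rw [hsum]
    simp only [hquad]
    simp only [hterm, hPJ, J₁.norm_map]
    exact hV (J₀' a)

end Extension

/-! ### The Kolmogorov space of the kernel -/

section Kolmogorov

/-- The Hausdorff completion of a vector space for the seminorm pulled back along a linear map into
an inner product space. It lives in the universe of the vector space, not in that of the target. -/
theorem exists_completion {X : Type u} [AddCommGroup X] [Module ℂ X] {G : Type w}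
    [NormedAddCommGroup G] [InnerProductSpace ℂ G] (Φ : X →ₗ[ℂ] G) :
    ∃ (M : Type u) (_ : NormedAddCommGroup M) (_ : InnerProductSpace ℂ M) (_ : CompleteSpace M)
      (ι : X →ₗ[ℂ] M), DenseRange ι ∧ ∀ x y, ⟪ι x, ι y⟫_ℂ = ⟪Φ x, Φ y⟫_ℂ := by
  let core : PreInnerProductSpace.Core ℂ X :=
    { inner := fun x y => ⟪Φ x, Φ y⟫_ℂ
      conj_inner_symm := fun x y => inner_conj_symm _ _
      re_inner_nonneg := fun x => inner_self_nonneg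
      add_left := fun x y z => by rw [map_add, inner_add_left]
      smul_left := fun x y c => by rw [map_smul, inner_smul_left] }
  let _ : SeminormedAddCommGroup X := InnerProductSpace.Core.toSeminormedAddCommGroup (𝕜 := ℂ)
  let _ : InnerProductSpace ℂ X := InnerProductSpace.ofCore core
  refine ⟨UniformSpace.Completion X, inferInstance, inferInstance, inferInstance,
    (UniformSpace.Completion.toComplL (𝕜 := ℂ) (E := X)).toLinearMap,
    UniformSpace.Completion.denseRange_coe, fun x y => ?_⟩
  exact UniformSpace.Completion.inner_coe x y

variable {d : ℕ} {H : Type u} [NormedAddCommGroup H] [InnerProductSpace ℂ H]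

/-- Positive definiteness of `K - K_Σ`, read off on the Kolmogorov vectors `φ α u` of `K`. -/
theorem KernelLE.sum_norm_sq_le {G : Type w} [NormedAddCommGroup G] [InnerProductSpace ℂ G]
    {K : Word d → Word d → H →L[ℂ] H} {φ : Word d → H →ₗ[ℂ] G}
    (hφ : ∀ α β u v, ⟪u, K α β v⟫_ℂ = ⟪φ α u, φ β v⟫_ℂ) (hle : KernelLE (shiftedKernel K) K)
    (x : Word d →₀ H) :
    ∑ i : Fin d, ‖x.sum fun α u => φ (α * FreeMonoid.of i) u‖ ^ 2 ≤
      ‖x.sum fun α u => φ α u‖ ^ 2 := by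
  let e := x.support.equivFin
  let a : Fin x.support.card → Word d := fun j => e.symm j
  have hinner : ∀ ψ : Word d → H → G, ⟪x.sum ψ, x.sum ψ⟫_ℂ =
      ∑ j, ∑ k, ⟪ψ (a j) (x (a j)), ψ (a k) (x (a k))⟫_ℂ := fun ψ => by
    have hsum : x.sum ψ = ∑ j, ψ (a j) (x (a j)) := by
      rw [Finsupp.sum, ← Finset.sum_coe_sort, ← e.symm.sum_comp]
    rw [hsum, sum_inner]
    simp only [inner_sum]
  have h := hle _ a fun j => x (a j)
  have h2 : (∑ j, ∑ k, ⟪x (a j), (K (a j) (a k) - shiftedKernel K (a j) (a k)) (x (a k))⟫_ℂ) =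
      ⟪x.sum fun α u => φ α u, x.sum fun α u => φ α u⟫_ℂ -
        ∑ i : Fin d, ⟪x.sum fun α u => φ (α * FreeMonoid.of i) u,
          x.sum fun α u => φ (α * FreeMonoid.of i) u⟫_ℂ := by
    simp only [hinner, shiftedKernel, sub_apply, sum_apply, inner_sub_right, inner_sum, hφ,
      Finset.sum_sub_distrib]
    congr 1
    conv_rhs => rw [Finset.sum_comm]
    exact Finset.sum_congr rfl fun j _ => Finset.sum_comm
  have h3 : (0 : ℂ) ≤ ((‖x.sum fun α u => φ α u‖ ^ 2 -
      ∑ i : Fin d, ‖x.sum fun α u => φ (α * FreeMonoid.of i) u‖ ^ 2 : ℝ) : ℂ) := by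
    rw [h2] at h
    simp only [inner_self_eq_norm_sq_to_K] at h
    push_cast
    exact h
  exact sub_nonneg.1 (Complex.zero_le_real.1 h3)

variable [CompleteSpace H]

/-- A normalized kernel `K` with `K_Σ ≤ K` and a Kolmogorov factorization has a dilation: on the
Kolmogorov space, `φ α u ↦ φ (α i) u` defines the adjoints of a row contraction. -/
theorem exists_isDilation_of_kernelLE {G : Type w} [NormedAddCommGroup G] [InnerProductSpace ℂ G]
    {K : Word d → Word d → H →L[ℂ] H} {φ : Word d → H →ₗ[ℂ] G}
    (hφ : ∀ α β u v, ⟪u, K α β v⟫_ℂ = ⟪φ α u, φ β v⟫_ℂ) (hle : KernelLE (shiftedKernel K) K)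
    (hone : K 1 1 = ContinuousLinearMap.id ℂ H) (i₀ : Fin d) :
    ∃ (E : Type u) (_ : NormedAddCommGroup E) (_ : InnerProductSpace ℂ E) (_ : CompleteSpace E)
      (S : Fin d → E →L[ℂ] E) (P : E →L[ℂ] E) (W : H →ₗᵢ[ℂ] E), IsDilation K S P W := by
  let Φ : (Word d →₀ H) →ₗ[ℂ] G := Finsupp.lsum ℂ φ
  obtain ⟨M, _, _, _, ι, hdense, hι⟩ := exists_completion Φ
  have hΦ : ∀ α u, Φ (Finsupp.single α u) = φ α u := fun α u => Finsupp.lsum_single _ _ _ _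
  have hιnorm : ∀ x, ‖ι x‖ ^ 2 = ‖Φ x‖ ^ 2 := fun x => by
    have h := hι x x
    simp only [inner_self_eq_norm_sq_to_K] at h
    exact_mod_cast h
  let τ : Fin d → (Word d →₀ H) →ₗ[ℂ] (Word d →₀ H) := fun i =>
    Finsupp.lmapDomain H ℂ (· * FreeMonoid.of i)
  have hτsum : ∀ x, ∑ i, ‖ι (τ i x)‖ ^ 2 ≤ ‖ι x‖ ^ 2 := by
    intro x
    have h : ∀ i, Φ (τ i x) = x.sum fun α u => φ (α * FreeMonoid.of i) u := fun i =>
      Finsupp.sum_mapDomain_index (fun _ => map_zero _) (fun _ _ _ => map_add _ _ _)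
    simp only [hιnorm, h]
    exact hle.sum_norm_sq_le hφ x
  have hτ : ∀ i x, ‖(ι ∘ₗ τ i) x‖ ≤ 1 * ‖ι x‖ := fun i x => by
    rw [one_mul]
    refine (pow_le_pow_iff_left₀ (norm_nonneg _) (norm_nonneg _) two_ne_zero).1 ?_
    exact (Finset.single_le_sum (f := fun i => ‖ι (τ i x)‖ ^ 2) (fun _ _ => by positivity)
      (Finset.mem_univ i)).trans (hτsum x)
  let T : Fin d → M →L[ℂ] M := fun i => (ι ∘ₗ τ i).extendOfNorm ι
  have hT : ∀ i x, T i (ι x) = ι (τ i x) := fun i x =>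
    LinearMap.extendOfNorm_eq hdense ⟨1, hτ i⟩ x
  have hTle : ∀ y, ∑ i, ‖T i y‖ ^ 2 ≤ ‖y‖ ^ 2 := by
    intro y
    induction y using hdense.induction_on with
    | hp => exact isClosed_le (by fun_prop) (by fun_prop)
    | ih x => simpa only [hT] using hτsum x
  let W₀ : H →ₗᵢ[ℂ] M :=
    { toLinearMap := ι ∘ₗ Finsupp.lsingle 1
      norm_map' := fun u => by
        have h := hφ 1 1 u u
        rw [hone, id_apply, inner_self_eq_norm_sq_to_K, inner_self_eq_norm_sq_to_K] at h
        have h2 : ‖ι (Finsupp.single 1 u)‖ ^ 2 = ‖u‖ ^ 2 := by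
          rw [hιnorm, hΦ]
          exact_mod_cast h.symm
        exact (pow_left_inj₀ (norm_nonneg _) (norm_nonneg _) two_ne_zero).1 h2 }
  have hword : ∀ α β u, adjoint (wordOp (fun i => adjoint (T i)) α) (ι (Finsupp.single β u)) =
      ι (Finsupp.single (β * α) u) := by
    intro α
    induction α using FreeMonoid.inductionOn' with
    | one => intro β u; rw [adjoint_wordOp_one_apply, mul_one]
    | of_mul i α ih =>
      intro β u
      have : τ i (Finsupp.single β u) = Finsupp.single (β * FreeMonoid.of i) u :=
        Finsupp.mapDomain_single
      rw [adjoint_wordOp_mul_apply, wordOp_of, adjoint_adjoint, hT, this, ih, mul_assoc]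
  refine exists_isDilation_of_rowContraction i₀ (V := fun i => adjoint (T i))
    (by simpa only [adjoint_adjoint] using hTle) W₀ fun α β u v => ?_
  change _ = ⟪adjoint (wordOp (fun i => adjoint (T i)) α) (ι (Finsupp.single 1 u)),
    adjoint (wordOp (fun i => adjoint (T i)) β) (ι (Finsupp.single 1 v))⟫_ℂ
  rw [hword, hword, one_mul, one_mul, hι, hΦ, hΦ, hφ]

end Kolmogorov

/-! ### The dilation of the moment kernel and the operator inequality -/

section MomentDilation

variable {Ω : Type v} [MeasurableSpace Ω] {μ : Measure Ω} {H : Type u}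
  [NormedAddCommGroup H] [InnerProductSpace ℂ H] [CompleteSpace H] {d : ℕ}
  {A : Fin d → Ω → H →L[ℂ] H}

theorem momentKernel_one_one [IsProbabilityMeasure μ] :
    momentKernel μ A 1 1 = ContinuousLinearMap.id ℂ H := by
  refine IsExpectation.expectation_eq fun u => ?_
  simp [adjoint_id]

/-- The moment kernel has a dilation if `K_Σ ≤ K`: the vectors `ω ↦ A^α(ω)^* u` of `L²(Ω; H)`
factor it. -/
theorem exists_isDilation_momentKernel [IsProbabilityMeasure μ] (hd : 1 ≤ d)
    (hA : ∀ i, IsRandomOperator μ (A i))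
    (hA2 : ∀ α : Word d, Integrable (fun ω => ‖wordOp (fun i => A i ω) α‖ ^ 2) μ)
    (hK : KernelLE (shiftedKernel (momentKernel μ A)) (momentKernel μ A)) :
    ∃ (E : Type u) (_ : NormedAddCommGroup E) (_ : InnerProductSpace ℂ E) (_ : CompleteSpace E)
      (S : Fin d → E →L[ℂ] E) (P : E →L[ℂ] E) (W : H →ₗᵢ[ℂ] E),
        IsDilation (momentKernel μ A) S P W := by
  let φ : Word d → H →ₗ[ℂ] Lp H 2 μ := fun α =>
    { toFun := fun u => (memLp_adjoint_wordOp hA hA2 α u).toLp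
      map_add' := fun u v => by
        rw [← MemLp.toLp_add]
        simp only [map_add]
        rfl
      map_smul' := fun c u => by
        rw [RingHom.id_apply, ← MemLp.toLp_const_smul]
        simp only [map_smul]
        rfl }
  refine exists_isDilation_of_kernelLE (φ := φ) (fun α β u v => ?_) hK momentKernel_one_one
    ⟨0, hd⟩
  rw [inner_momentKernel hA hA2, L2.inner_def]
  refine integral_congr_ae ?_
  filter_upwards [(memLp_adjoint_wordOp hA hA2 α u).coeFn_toLp,
    (memLp_adjoint_wordOp hA hA2 β v).coeFn_toLp] with ω h1 h2
  change _ = ⟪(memLp_adjoint_wordOp hA hA2 α u).toLp _ ω,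
    (memLp_adjoint_wordOp hA hA2 β v).toLp _ ω⟫_ℂ
  rw [h1, h2]

theorem expectation_polyOp_le {c : ℝ} (hA : ∀ i, IsRandomOperator μ (A i))
    (hA2 : ∀ α : Word d, Integrable (fun ω => ‖wordOp (fun i => A i ω) α‖ ^ 2) μ) (f : NCPoly d)
    (hc : ∀ u, ∫ ω, ‖adjoint (polyOp f (fun i => A i ω)) u‖ ^ 2 ∂μ ≤ c * ‖u‖ ^ 2) :
    expectation μ (fun ω => polyOp f (fun i => A i ω) ∘L adjoint (polyOp f (fun i => A i ω))) ≤
      c • ContinuousLinearMap.id ℂ H := by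
  rw [(isExpectation_polyOp hA hA2 f).expectation_eq, ContinuousLinearMap.le_def,
    isPositive_iff_complex]
  intro u
  set T := ∑ α ∈ (coeff f).support, ∑ β ∈ (coeff f).support,
    (coeff f α * star (coeff f β)) • momentKernel μ A α β
  have h : ⟪(c • ContinuousLinearMap.id ℂ H - T) u, u⟫_ℂ =
      ((c * ‖u‖ ^ 2 - ∫ ω, ‖adjoint (polyOp f (fun i => A i ω)) u‖ ^ 2 ∂μ : ℝ) : ℂ) := by
    rw [← inner_conj_symm, sub_apply, inner_sub_right, inner_expectation_polyOp hA hA2 f,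
      smul_apply, id_apply, inner_smul_right_eq_smul, inner_self_eq_norm_sq_to_K, map_sub,
      Complex.conj_ofReal]
    simp
  rw [h]
  exact ⟨rfl, sub_nonneg.2 (hc u)⟩

end MomentDilation

end FreeMoment

theorem corollary4
    {Ω : Type v} [MeasurableSpace Ω] (μ : Measure Ω) [IsProbabilityMeasure μ]
    {H : Type u} [NormedAddCommGroup H] [InnerProductSpace ℂ H] [CompleteSpace H]
    (d : ℕ) (hd : 1 ≤ d) (A : Fin d → Ω → H →L[ℂ] H)
    (hA : ∀ i, FreeMoment.IsRandomOperator μ (A i))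
    (hA2 : ∀ α : FreeMoment.Word d,
      Integrable (fun ω => ‖FreeMoment.wordOp (fun i => A i ω) α‖ ^ 2) μ)
    (hK : FreeMoment.KernelLE
      (FreeMoment.shiftedKernel (FreeMoment.momentKernel μ A)) (FreeMoment.momentKernel μ A)) :
    -- the moment kernel has a dilation
    (∃ (E : Type u) (_ : NormedAddCommGroup E) (_ : InnerProductSpace ℂ E) (_ : CompleteSpace E)
      (S : Fin d → E →L[ℂ] E) (P : E →L[ℂ] E) (W : H →ₗᵢ[ℂ] E),
        FreeMoment.IsDilation (FreeMoment.momentKernel μ A) S P W) ∧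
    -- the inequalities hold for the Cuntz family of every such dilation
    (∀ (E : Type w) [NormedAddCommGroup E] [InnerProductSpace ℂ E] [CompleteSpace E]
      (S : Fin d → E →L[ℂ] E) (P : E →L[ℂ] E) (W : H →ₗᵢ[ℂ] E),
        FreeMoment.IsDilation (FreeMoment.momentKernel μ A) S P W →
        ∀ (f : FreeMoment.NCPoly d) (u : H),
          Integrable
            (fun ω => ‖adjoint (FreeMoment.polyOp f (fun i => A i ω)) u‖ ^ 2) μ ∧
          ∫ ω, ‖adjoint (FreeMoment.polyOp f (fun i => A i ω)) u‖ ^ 2 ∂μ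
            ≤ ‖FreeMoment.polyOp f S‖ ^ 2 * ‖u‖ ^ 2 ∧
          ‖FreeMoment.polyOp f S‖ ^ 2 * ‖u‖ ^ 2
            ≤ ‖FreeMoment.polyOp f (FreeMoment.leftCreation d)‖ ^ 2 * ‖u‖ ^ 2) ∧
    -- the operator form of the inequality
    (∀ f : FreeMoment.NCPoly d,
      FreeMoment.IsExpectation μ
        (fun ω => FreeMoment.polyOp f (fun i => A i ω) ∘L
          adjoint (FreeMoment.polyOp f (fun i => A i ω)))
        (FreeMoment.expectation μ (fun ω => FreeMoment.polyOp f (fun i => A i ω) ∘L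
          adjoint (FreeMoment.polyOp f (fun i => A i ω)))) ∧
      FreeMoment.expectation μ (fun ω => FreeMoment.polyOp f (fun i => A i ω) ∘L
          adjoint (FreeMoment.polyOp f (fun i => A i ω)))
        ≤ (‖FreeMoment.polyOp f (FreeMoment.leftCreation d)‖ ^ 2) •
          ContinuousLinearMap.id ℂ H) := by
  obtain ⟨E₀, _, _, _, S₀, P₀, W₀, h₀⟩ :=
    FreeMoment.exists_isDilation_momentKernel hd hA hA2 hK
  refine ⟨⟨E₀, inferInstance, inferInstance, inferInstance, S₀, P₀, W₀, h₀⟩, ?_, fun f => ⟨?_, ?_⟩⟩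
  · intro E _ _ _ S P W h f u
    have hf := FreeMoment.memLp_adjoint_polyOp hA hA2 f u
    refine ⟨(memLp_two_iff_integrable_sq_norm hf.1).1 hf,
      FreeMoment.integral_norm_sq_le hA hA2 h f u, ?_⟩
    gcongr
    exact h.cuntz.norm_polyOp_le f
  · have h := FreeMoment.isExpectation_polyOp hA hA2 f
    rwa [h.expectation_eq]
  · refine FreeMoment.expectation_polyOp_le hA hA2 f fun u =>
      (FreeMoment.integral_norm_sq_le hA hA2 h₀ f u).trans ?_
    gcongr
    exact h₀.cuntz.norm_polyOp_le f
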